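/- Let $\mathbb F$ be $\mathbb R$ or $\mathbb C$, let $X$ be a set, $\boldsymbol H=\{\mathcal H_x\}_{x\in X}$ a family of Hilbert spaces over $\mathbb F$, and $P=\{X_s\}_{s\in S}$ a partition of $X$ into nonempty sets. A kernel is a map $K$ on $X\times X$ with $K(x,y)\in\mathcal B(\mathcal H_y,\mathcal H_x)$. It is partially Hermitian if $K(x,y)^*=K(y,x)$ for all $s\in S$ and $x,y\in X_s$; it is partially positive semidefinite if it is partially Hermitian and $\sum_{i,j=1}^n\langle K(x_j,x_i)h_i,h_j\rangle\ge 0$ for all $s\in S$, $n\in\mathbb N$, $x_1,\dots,x_n\in X_s$, $h_i\in\mathcal H_{x_i}$. For partially Hermitian $K,L$ write $K\le_P L$ if $L-K$ is partially positive semidefinite. Partially positive semidefinite kernels $K_1,K_2$ are disjoint if every partially positive semidefinite $L$ with $L\le_P K_1$ and $L\le_P K_2$ vanishes on $X_s\times X_s$ for all $s\in S$. For sections $f,g$ of finite support of $\{\mathcal H_x\}_{x\in X_s}$ put $[f,g]_K=\sum_{x,y\in X_s}\langle K(y,x)f(x),g(y)\rangle$. A Krein space is a vector space $\mathcal K$ with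 an inner product $[\cdot,\cdot]$ (linear in the first variable, conjugate symmetric) admitting a fundamental symmetry, that is, a linear operator $J$ with $J^2=I$ such that $[J\cdot,\cdot]$ is a positive definite inner product making $\mathcal K$ a Hilbert space; its strong topology is the one of this Hilbert space (it does not depend on $J$). Let $K$ be a partially Hermitian kernel. The following assertions are equivalent. (1) There is a partially positive semidefinite kernel $L$ with $-L\le_P K\le_P L$. (1)$'$ There is a partially positive semidefinite kernel $L$ with $K\le_P L$. (2) There is a partially positive semidefinite kernel $L$ such that, for each $s\in S$, $|[f,g]_K|\le [f,f]_L^{1/2}[g,g]_L^{1/2}$ for all sections $f,g$ of finite support of $\{\mathcal H_x\}_{x\in X_s}$. (3) $K=K_1-K_2$ for some partially positive semidefinite kernels $K_1,K_2$. (3)$'$ $K=K_1-K_2$ for some disjoint partially positive semidefinite kernels $K_1,K_2$. (4) There is a minimal Krein space partial linearisation of $K$, that is, there are Krein spaces $\mathcal K_s$ ($s\in S$) and bounded linear operators $V_x\colon\mathcal H_x\to\mathcal K_s$ ($s\in S$, $x\in X_s$) such that $\langle K(x,y)k,h\rangle_{\mathcal H_x}=[V_yk,V_xh]_{\mathcal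 K_s}$ for all $s\in S$, $x,y\in X_s$, $h\in\mathcal H_x$, $k\in\mathcal H_y$, and such that each $\mathcal K_s$ is the closed linear span of $\bigcup_{x\in X_s}V_x\mathcal H_x$. (5) For each $s\in S$ there is a reproducing kernel Krein space $\mathcal R_s$ with kernel $K^s=K|_{X_s\times X_s}$, that is, a linear subspace $\mathcal R_s$ of $\prod_{x\in X_s}\mathcal H_x$ with an inner product $[\cdot,\cdot]$ making it a Krein space, such that, for all $x\in X_s$ and $h\in\mathcal H_x$, the section $K^s_xh=(K(y,x)h)_{y\in X_s}$ belongs to $\mathcal R_s$ and $\langle f(x),h\rangle_{\mathcal H_x}=[f,K^s_xh]$ for all $f\in\mathcal R_s$. -/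

import Mathlib

universe u v w

/-! ### Krein spaces -/

section Krein

variable (𝕜 : Type*) (E : Type*) [RCLike 𝕜] [AddCommGroup E] [Module 𝕜 E]

/-- A (possibly indefinite, possibly degenerate) inner product `[·,·]` on the vector space `E`:
linear in the first variable and (conjugate) symmetric. -/
structure IndefiniteInner where
  /-- the value `[x, y]` -/
  ip : E → E → 𝕜
  add_left : ∀ x y z, ip (x + y) z = ip x z + ip y z
  smul_left : ∀ (a : 𝕜) (x y : E), ip (a • x) y = a * ip x y
  conj_symm : ∀ x y, starRingEnd 𝕜 (ip y x) = ip x y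

variable {𝕜 E}

/-- A fundamental symmetry of `(E, [·,·])`: a linear operator `J` with `J² = I` such that
`⟨x, y⟩_J = [J x, y]` is a positive definite inner product for which `E` is a Hilbert space.
The field `core` is this inner product (Mathlib's inner products are linear in the
second variable, whence the order of the arguments in `inner_eq`). -/
structure FundamentalSymmetry (b : IndefiniteInner 𝕜 E) where
  /-- the operator `J` -/
  J : E →ₗ[𝕜] E
  J_J : ∀ x, J (J x) = x
  /-- the positive definite inner product `⟨·,·⟩_J` -/
  core : InnerProductSpace.Core 𝕜 E
  inner_eq : ∀ x y, core.inner y x = b.ip (J x) y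
  complete : @CompleteSpace E
    core.toNormedAddCommGroup.toMetricSpace.toPseudoMetricSpace.toUniformSpace

/-- The unitary norm `‖x‖ = ⟨x, x⟩_J ^ (1/2)` attached to a fundamental symmetry. -/
noncomputable def FundamentalSymmetry.norm {b : IndefiniteInner 𝕜 E}
    (F : FundamentalSymmetry b) (x : E) : ℝ :=
  F.core.toNormedAddCommGroup.toNorm.norm x

/-- The strong topology, i.e. the topology of the unitary norm attached to a fundamental
symmetry (all fundamental symmetries of a Krein space give the same topology). -/
@[reducible] noncomputable def FundamentalSymmetry.strongTopology {b : IndefiniteInner 𝕜 E}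
    (F : FundamentalSymmetry b) : TopologicalSpace E :=
  F.core.toNormedAddCommGroup.toMetricSpace.toPseudoMetricSpace.toUniformSpace.toTopologicalSpace

/-- `(E, [·,·])` is a Krein space: it has a fundamental symmetry. -/
def IsKreinSpace (b : IndefiniteInner 𝕜 E) : Prop := Nonempty (FundamentalSymmetry b)

end Krein

/-! ### Operator valued kernels on a bundle of Hilbert spaces -/

section Kernels

variable (𝕜 : Type*) [RCLike 𝕜] {X : Type u} {S : Type v} (H : X → Type w)
  [∀ x, NormedAddCommGroup (H x)] [∀ x, InnerProductSpace 𝕜 (H x)]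

/-- `H`-operator valued kernels on `X`: `K x y` is a bounded operator `H y → H x`. -/
abbrev OpKernel := ∀ x y : X, H y →L[𝕜] H x

variable {𝕜 H} (P : S → Set X)

/-- The sesquilinear form
`[f, g]_K = ∑_{x, y} ⟨K(y, x) f(x), g(y)⟩` for sections `f`, `g` of finite support
of the bundle restricted to the subset `A` of `X`. -/
noncomputable def kernelForm (A : Set X) (K : OpKernel 𝕜 H) (f g : Π₀ x : A, H x) : 𝕜 :=
  open Classical in
  f.sum fun x fx => g.sum fun y gy => inner 𝕜 gy (K y x fx)

/-- `K` vanishes on every block `P s × P s`. -/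
def IsPartiallyZero (K : OpKernel 𝕜 H) : Prop :=
  ∀ s, ∀ x ∈ P s, ∀ y ∈ P s, K x y = 0

section Complete

variable [∀ x, CompleteSpace (H x)]

/-- Partially Hermitian kernels: `K(x, y)* = K(y, x)` for `x, y` in the same piece. -/
def IsPartiallyHermitian (K : OpKernel 𝕜 H) : Prop :=
  ∀ s, ∀ x ∈ P s, ∀ y ∈ P s, ContinuousLinearMap.adjoint (K x y) = K y x

/-- Partially positive semidefinite kernels: partially Hermitian with
`∑_{i,j} ⟨K(x_j, x_i) h_i, h_j⟩ ≥ 0` for points in the same piece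
(the sum is real since `K` is partially Hermitian). -/
def IsPartiallyPosSemidef (K : OpKernel 𝕜 H) : Prop :=
  IsPartiallyHermitian P K ∧
  ∀ (s : S) (n : ℕ) (x : Fin n → P s) (h : ∀ i, H (x i)),
    0 ≤ RCLike.re (∑ i, ∑ j, inner 𝕜 (h j) (K (x j) (x i) (h i)))

/-- Partial domination `K ≤_P L`. -/
def PartialLE (K L : OpKernel 𝕜 H) : Prop := IsPartiallyPosSemidef P (L - K)

/-- Disjointness of partially positive semidefinite kernels: only kernels that are null on every
block are partially positive semidefinite and partially dominated by both. -/
def PartiallyDisjoint (K₁ K₂ : OpKernel 𝕜 H) : Prop :=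
  ∀ L : OpKernel 𝕜 H, IsPartiallyPosSemidef P L → PartialLE P L K₁ → PartialLE P L K₂ →
    IsPartiallyZero P L

end Complete

/-- A Krein space partial linearisation `({𝒦_s}, {V_x})` of `K` with respect to `P`. As every
`x` lies in exactly one piece of a partition, the family `{V_x}` is indexed by the pairs
`s`, `x ∈ P s`. The fundamental symmetries are fixed only in order to speak about the strong
topologies. -/
structure KreinPartialLinearisation (K : OpKernel 𝕜 H) where
  /-- the Krein spaces `𝒦_s` -/
  space : S → Type (max u w)
  [addCommGroup : ∀ s, AddCommGroup (space s)]
  [module : ∀ s, Module 𝕜 (space s)]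
  /-- the indefinite inner product of `𝒦_s` -/
  form : ∀ s, IndefiniteInner 𝕜 (space s)
  /-- a fundamental symmetry of `𝒦_s` -/
  symmetry : ∀ s, FundamentalSymmetry (form s)
  /-- the operators `V_x : H_x → 𝒦_s` for `x` in the piece `s` -/
  V : ∀ (s : S) (x : P s), H x →ₗ[𝕜] space s
  V_bounded : ∀ (s : S) (x : P s), ∃ C : ℝ, ∀ h : H x, (symmetry s).norm (V s x h) ≤ C * ‖h‖
  factorisation : ∀ (s : S) (x y : P s) (h : H x) (k : H y),
    inner 𝕜 h (K x y k) = (form s).ip (V s y k) (V s x h)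

attribute [instance] KreinPartialLinearisation.addCommGroup KreinPartialLinearisation.module

/-- Minimality: `𝒦_s` is the closed linear span of the ranges of `V_x`, `x ∈ P s`. -/
def KreinPartialLinearisation.IsMinimal {P : S → Set X} {K : OpKernel 𝕜 H}
    (Λ : KreinPartialLinearisation P K) : Prop :=
  ∀ s, @Dense (Λ.space s) (Λ.symmetry s).strongTopology
    (Submodule.span 𝕜 (⋃ x : P s, Set.range (Λ.V s x)) : Set (Λ.space s))

/-- `(R, [·,·])`, with `R` a vector space of sections of the bundle `{H_x}_{x ∈ A}`, is a
reproducing kernel Krein space with reproducing kernel `K` restricted to `A × A`. -/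
structure IsReproducingKernelKreinSpace (A : Set X) (K : OpKernel 𝕜 H)
    (R : Submodule 𝕜 (∀ x : A, H x)) (b : IndefiniteInner 𝕜 R) : Prop where
  isKrein : IsKreinSpace b
  kernel_mem : ∀ (x : A) (h : H x), (fun y : A => K y x h) ∈ R
  reproducing : ∀ (f : R) (x : A) (h : H x),
    inner 𝕜 h ((f : ∀ x : A, H x) x) = b.ip f ⟨fun y : A => K y x h, kernel_mem x h⟩

end Kernels

/-! All conditions only see the blocks, so the work is done on one block and the results are glued,
with zero off the blocks.

The order-theoretic assertions are elementary. From `K ≤ L` comes `K = L - (L - K)`; from `K = K₁ -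
K₂` comes `-(K₁ + K₂) ≤ K ≤ K₁ + K₂`. The form inequality follows from Cauchy–Schwarz for `L + K`
and `L - K`, and yields `K ≤ L` when `g = f`.

Disjointness is obtained by subtracting from `K₁` and `K₂` a maximal common minorant
(`exists_maximal_minorant`): Zorn's lemma applies because entries of minorants are uniformly bounded
and chains therefore have weak limit points.

The main step turns disjoint `K₁`, `K₂` into a reproducing kernel Krein space. Write `Kᵢ(x, y) =
Vᵢ(x)* Vᵢ(y)` with total `Vᵢ` into Hilbert spaces `Mᵢ`, and map `(m₁, m₂)` to the section `V₁* m₁ +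
V₂* m₂`. If it vanishes, then `f = V₁* m₁ = -V₂* m₂`, and a small multiple of `f ⊗ f` is a common
minorant; so `f = 0`, and `m₁ = m₂ = 0` by totality. The range thus inherits the Krein structure of
`M₁ ⊕ (-M₂)`, and its kernel is `K₁ - K₂`.

A reproducing kernel space gives a minimal linearisation by `V_x h = K_x h`: boundedness is the
closed graph theorem, minimality is nondegeneracy. Conversely, taking adjoints for the Hilbert
product of a fundamental symmetry `J`, the kernel `L(x, y) = V_x* V_y` dominates `K` because `I - J
≥ 0`. -/

open Filter Topology

/-! ### Kernels on a single block -/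

section SingleBlock

variable {𝕜 : Type*} [RCLike 𝕜] {Y : Type u} {G : Y → Type w}
  [∀ y, NormedAddCommGroup (G y)] [∀ y, InnerProductSpace 𝕜 (G y)]

open Classical in
/-- The sesquilinear form of a kernel on the sections of finite support. -/
noncomputable def sectionForm (K : OpKernel 𝕜 G) (f g : Π₀ y, G y) : 𝕜 :=
  f.sum fun x fx => g.sum fun y gy => inner 𝕜 gy (K y x fx)

open Classical in
theorem sectionForm_eq_sum (K : OpKernel 𝕜 G) (f g : Π₀ y, G y) {s t : Finset Y}
    (hs : f.support ⊆ s) (ht : g.support ⊆ t) :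
    sectionForm K f g = ∑ x ∈ s, ∑ y ∈ t, inner 𝕜 (g y) (K y x (f x)) := by
  rw [sectionForm, DFinsupp.sum_of_support_subset hs (by simp)]
  refine Finset.sum_congr rfl fun x _ => ?_
  rw [DFinsupp.sum_of_support_subset ht (by simp)]

open Classical in
theorem sectionForm_add_right (K : OpKernel 𝕜 G) (f g g' : Π₀ y, G y) :
    sectionForm K f (g + g') = sectionForm K f g + sectionForm K f g' := by
  have h : (g + g').support ⊆ g.support ∪ g'.support := DFinsupp.support_add
  rw [sectionForm_eq_sum K f _ subset_rfl h,
    sectionForm_eq_sum K f g subset_rfl (Finset.subset_union_left (s₂ := g'.support)),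
    sectionForm_eq_sum K f g' subset_rfl (Finset.subset_union_right (s₁ := g.support)),
    ← Finset.sum_add_distrib]
  refine Finset.sum_congr rfl fun x _ => ?_
  rw [← Finset.sum_add_distrib]
  exact Finset.sum_congr rfl fun y _ => by rw [DFinsupp.add_apply, inner_add_left]

open Classical in
theorem sectionForm_smul_right (K : OpKernel 𝕜 G) (f g : Π₀ y, G y) (a : 𝕜) :
    sectionForm K f (a • g) = starRingEnd 𝕜 a * sectionForm K f g := by
  have h : (a • g).support ⊆ g.support := DFinsupp.support_smul a g
  rw [sectionForm_eq_sum K f _ subset_rfl h, sectionForm_eq_sum K f g subset_rfl subset_rfl,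
    Finset.mul_sum]
  refine Finset.sum_congr rfl fun x _ => ?_
  rw [Finset.mul_sum]
  exact Finset.sum_congr rfl fun y _ => by rw [DFinsupp.smul_apply, inner_smul_left]

open Classical in
@[simp]
theorem sectionForm_single (K : OpKernel 𝕜 G) (x y : Y) (h : G x) (k : G y) :
    sectionForm K (DFinsupp.single x h) (DFinsupp.single y k) = inner 𝕜 k (K y x h) := by
  rw [sectionForm, DFinsupp.sum_single_index, DFinsupp.sum_single_index] <;> simp

open Classical in
theorem sectionForm_add (K L : OpKernel 𝕜 G) (f g : Π₀ y, G y) :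
    sectionForm (K + L) f g = sectionForm K f g + sectionForm L f g := by
  simp only [sectionForm_eq_sum _ f g subset_rfl subset_rfl, Pi.add_apply,
    add_apply, inner_add_right, Finset.sum_add_distrib]

open Classical in
theorem sectionForm_sub (K L : OpKernel 𝕜 G) (f g : Π₀ y, G y) :
    sectionForm (K - L) f g = sectionForm K f g - sectionForm L f g := by
  simp only [sectionForm_eq_sum _ f g subset_rfl subset_rfl, Pi.sub_apply,
    sub_apply, inner_sub_right, Finset.sum_sub_distrib]

@[simp]
theorem sectionForm_zero (f g : Π₀ y, G y) : sectionForm (0 : OpKernel 𝕜 G) f g = 0 := by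
  classical
  simp [sectionForm_eq_sum _ f g subset_rfl subset_rfl]

open Classical in
/-- The form of a kernel that factors through an operator `T` on an inner product space. -/
theorem sectionForm_eq_inner {E : Type*} [NormedAddCommGroup E] [InnerProductSpace 𝕜 E]
    (V : ∀ y, G y →ₗ[𝕜] E) (T : E →ₗ[𝕜] E) {K : OpKernel 𝕜 G}
    (hV : ∀ x y h k, inner 𝕜 (V x h) (T (V y k)) = inner 𝕜 h (K x y k)) (f g : Π₀ y, G y) :
    sectionForm K f g =
      inner 𝕜 (∑ y ∈ g.support, V y (g y)) (T (∑ x ∈ f.support, V x (f x))) := by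
  rw [sectionForm_eq_sum _ f g subset_rfl subset_rfl, map_sum, inner_sum]
  refine Finset.sum_congr rfl fun x _ => ?_
  rw [sum_inner]
  exact Finset.sum_congr rfl fun y _ => (hV _ _ _ _).symm

variable [∀ y, CompleteSpace (G y)]

/-- Positive semidefinite kernels: Hermitian kernels with a nonnegative form. -/
structure IsPosSemidefKernel (K : OpKernel 𝕜 G) : Prop where
  hermitian : ∀ x y, ContinuousLinearMap.adjoint (K x y) = K y x
  nonneg : ∀ f, 0 ≤ RCLike.re (sectionForm K f f)

open Classical in
theorem sectionForm_conj {K : OpKernel 𝕜 G}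
    (hK : ∀ x y, ContinuousLinearMap.adjoint (K x y) = K y x) (f g : Π₀ y, G y) :
    starRingEnd 𝕜 (sectionForm K g f) = sectionForm K f g := by
  rw [sectionForm_eq_sum _ f g subset_rfl subset_rfl,
    sectionForm_eq_sum _ g f subset_rfl subset_rfl, map_sum]
  simp only [map_sum]
  rw [Finset.sum_comm]
  refine Finset.sum_congr rfl fun x _ => Finset.sum_congr rfl fun y _ => ?_
  rw [inner_conj_symm, ← ContinuousLinearMap.adjoint_inner_right, hK]

namespace IsPosSemidefKernel

variable {K L : OpKernel 𝕜 G}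

theorem zero : IsPosSemidefKernel (0 : OpKernel 𝕜 G) :=
  ⟨fun x y => by simp, fun f => by simp⟩

theorem add (hK : IsPosSemidefKernel K) (hL : IsPosSemidefKernel L) :
    IsPosSemidefKernel (K + L) :=
  ⟨fun x y => by simp [hK.hermitian, hL.hermitian], fun f => by
    rw [sectionForm_add, map_add]; exact add_nonneg (hK.nonneg f) (hL.nonneg f)⟩

/-- A positive semidefinite kernel is the Gram kernel of a total family of bounded operators
into a Hilbert space. -/
theorem exists_factorisation (hK : IsPosSemidefKernel K) :
    ∃ (M : Type (max u w)) (_ : NormedAddCommGroup M) (_ : InnerProductSpace 𝕜 M)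
      (_ : CompleteSpace M) (V : ∀ y, G y →L[𝕜] M),
      (∀ x y h k, inner 𝕜 (V x h) (V y k) = inner 𝕜 h (K x y k)) ∧
      ∀ m, (∀ x h, inner 𝕜 (V x h) m = 0) → m = 0 := by
  classical
  -- The form may be degenerate; the completion below also divides out its null vectors. The
  -- arguments are swapped because `inner` is conjugate linear in the first one.
  let c : PreInnerProductSpace.Core 𝕜 (Π₀ y, G y) :=
    { inner := fun f g => sectionForm K g f
      conj_inner_symm := fun f g => sectionForm_conj hK.hermitian g f
      re_inner_nonneg := fun f => hK.nonneg f
      add_left := fun f f' g => sectionForm_add_right K g f f'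
      smul_left := fun f g a => sectionForm_smul_right K g f a }
  let _ : SeminormedAddCommGroup (Π₀ y, G y) :=
    InnerProductSpace.Core.toSeminormedAddCommGroup (𝕜 := 𝕜) (c := c)
  let _ : InnerProductSpace 𝕜 (Π₀ y, G y) := .ofCore c
  let ι : (Π₀ y, G y) →L[𝕜] UniformSpace.Completion (Π₀ y, G y) :=
    UniformSpace.Completion.toComplL
  have hι : ∀ f g, inner 𝕜 (ι f) (ι g) = sectionForm K g f :=
    fun f g => UniformSpace.Completion.inner_coe f g
  let V₀ : ∀ y, G y →ₗ[𝕜] UniformSpace.Completion (Π₀ y, G y) :=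
    fun y => ι.toLinearMap ∘ₗ DFinsupp.lsingle y
  have hV₀ : ∀ x y h k, inner 𝕜 (V₀ x h) (V₀ y k) = inner 𝕜 h (K x y k) := by
    intro x y h k
    refine (hι _ _).trans ?_
    exact sectionForm_single K y x k h
  refine ⟨UniformSpace.Completion (Π₀ y, G y), inferInstance, inferInstance, inferInstance,
    fun y => (V₀ y).mkContinuous (√‖K y y‖) fun h => ?_, fun x y h k => hV₀ x y h k, ?_⟩
  -- The bound comes from `‖V y h‖² = ⟨h, K y y h⟩ ≤ ‖K y y‖ ‖h‖²`.
  · rw [← abs_of_nonneg (norm_nonneg (V₀ y h)),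
      ← abs_of_nonneg (mul_nonneg (Real.sqrt_nonneg ‖K y y‖) (norm_nonneg h)), ← sq_le_sq,
      ← inner_self_eq_norm_sq (𝕜 := 𝕜), hV₀, mul_pow, Real.sq_sqrt (norm_nonneg _)]
    calc RCLike.re (inner 𝕜 h (K y y h)) ≤ ‖h‖ * ‖K y y h‖ := re_inner_le_norm _ _
      _ ≤ ‖h‖ * (‖K y y‖ * ‖h‖) := by gcongr; exact (K y y).le_opNorm h
      _ = _ := by ring
  · intro m hm
    have hm' : ∀ f, inner 𝕜 (ι f) m = 0 := by
      intro f
      induction f using DFinsupp.induction with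
      | h0 => simp
      | ha i b f _ _ ih =>
        rw [map_add, inner_add_left, ih, add_zero]
        exact hm i b
    exact UniformSpace.Completion.denseRange_coe.eq_zero_of_inner_right 𝕜 hm'

theorem norm_sectionForm_le (hK : IsPosSemidefKernel K) (f g : Π₀ y, G y) :
    ‖sectionForm K f g‖ ≤
      √(RCLike.re (sectionForm K f f)) * √(RCLike.re (sectionForm K g g)) := by
  classical
  obtain ⟨M, _, _, _, V, hV, -⟩ := hK.exists_factorisation
  have h := sectionForm_eq_inner (fun y => (V y).toLinearMap) LinearMap.id hV
  rw [h f g, h f f, h g g]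
  simp only [LinearMap.id_apply]
  rw [inner_self_eq_norm_sq, inner_self_eq_norm_sq, Real.sqrt_sq (norm_nonneg _),
    Real.sqrt_sq (norm_nonneg _), mul_comm]
  exact norm_inner_le_norm _ _

/-- The entries of a positive semidefinite kernel are controlled by the diagonal of a dominating
kernel. -/
theorem norm_apply_le (hL : IsPosSemidefKernel L) (h : IsPosSemidefKernel (K - L)) (x y : Y) :
    ‖L x y‖ ≤ √‖K x x‖ * √‖K y y‖ := by
  classical
  have key : ∀ (z : Y) (v : G z), √(RCLike.re (inner 𝕜 v (L z z v))) ≤ √‖K z z‖ * ‖v‖ := by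
    intro z v
    rw [← Real.sqrt_sq (norm_nonneg v), ← Real.sqrt_mul (norm_nonneg _)]
    refine Real.sqrt_le_sqrt ?_
    have h1 := h.nonneg (DFinsupp.single z v)
    rw [sectionForm_sub, sectionForm_single, sectionForm_single, map_sub] at h1
    calc RCLike.re (inner 𝕜 v (L z z v)) ≤ RCLike.re (inner 𝕜 v (K z z v)) := by linarith
      _ ≤ ‖v‖ * ‖K z z v‖ := re_inner_le_norm _ _
      _ ≤ ‖v‖ * (‖K z z‖ * ‖v‖) := by gcongr; exact (K z z).le_opNorm v
      _ = _ := by ring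
  -- Cauchy–Schwarz for the form of `L` on sections supported at one point; the diagonal of `L` is
  -- then compared with that of `K`.
  refine ContinuousLinearMap.opNorm_le_of_re_inner_le (by positivity) fun v w hv hw => ?_
  have h2 := hL.norm_sectionForm_le (DFinsupp.single y v) (DFinsupp.single x w)
  simp only [sectionForm_single] at h2
  have h3 := key x w
  have h4 := key y v
  rw [hw, mul_one] at h3
  rw [hv, mul_one] at h4
  calc RCLike.re (inner 𝕜 (L x y v) w) ≤ ‖inner 𝕜 (L x y v) w‖ := RCLike.re_le_norm _
    _ = ‖inner 𝕜 w (L x y v)‖ := norm_inner_symm _ _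
    _ ≤ √(RCLike.re (inner 𝕜 v (L y y v))) * √(RCLike.re (inner 𝕜 w (L x x w))) := h2
    _ ≤ √‖K y y‖ * √‖K x x‖ := by gcongr
    _ = _ := mul_comm _ _

end IsPosSemidefKernel

end SingleBlock

/-! ### Weak compactness of bounded families of operators -/

section WeakLimit

variable {𝕜 E F : Type*} [RCLike 𝕜] [NormedAddCommGroup E] [InnerProductSpace 𝕜 E]
  [NormedAddCommGroup F] [InnerProductSpace 𝕜 F] [CompleteSpace F]

/-- Along an ultrafilter every bounded family of operators converges weakly. -/
theorem exists_tendsto_inner_of_norm_le {ι : Type*} (U : Ultrafilter ι) (T : ι → E →L[𝕜] F)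
    {C : ℝ} (hT : ∀ i, ‖T i‖ ≤ C) :
    ∃ T' : E →L[𝕜] F, ∀ (h : F) (k : E),
      Tendsto (fun i => inner 𝕜 h (T i k)) U (𝓝 (inner 𝕜 h (T' k))) := by
  have bound : ∀ (k : E) (h : F) i, ‖inner 𝕜 (T i k) h‖ ≤ C * ‖k‖ * ‖h‖ := fun k h i =>
    (norm_inner_le_norm _ _).trans <| by
      gcongr; exact (T i).le_of_opNorm_le (hT i) k
  have lim : ∀ (k : E) (h : F), ∃ a : 𝕜, ‖a‖ ≤ C * ‖k‖ * ‖h‖ ∧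
      Tendsto (fun i => inner 𝕜 (T i k) h) U (𝓝 a) := by
    intro k h
    obtain ⟨a, ha, hlim⟩ := (isCompact_closedBall (0 : 𝕜) (C * ‖k‖ * ‖h‖)).ultrafilter_le_nhds
      (U.map fun i => inner 𝕜 (T i k) h)
      (by
        rw [le_principal_iff]
        exact Filter.mem_map.2 (univ_mem' fun i => by simpa using bound k h i))
    exact ⟨a, by simpa using ha, hlim⟩
  choose B hB hlim using lim
  -- The limits inherit sesquilinearity and the bound `C`, so Riesz representation produces the
  -- operator.
  let β : E →ₗ⋆[𝕜] F →ₗ[𝕜] 𝕜 := LinearMap.mk₂'ₛₗ _ _ B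
    (fun k k' h => tendsto_nhds_unique (hlim _ _) <| by
      simpa only [map_add, inner_add_left] using (hlim k h).add (hlim k' h))
    (fun c k h => tendsto_nhds_unique (hlim _ _) <| by
      simpa only [map_smul, inner_smul_left, smul_eq_mul] using (hlim k h).const_mul _)
    (fun k h h' => tendsto_nhds_unique (hlim _ _) <| by
      simpa only [inner_add_right] using (hlim k h).add (hlim k h'))
    (fun c k h => tendsto_nhds_unique (hlim _ _) <| by
      simpa only [inner_smul_right, smul_eq_mul, RingHom.id_apply] using (hlim k h).const_mul _)
  let β' : E →L⋆[𝕜] StrongDual 𝕜 F := β.mkContinuous₂ C fun k h => hB k h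
  let T' : E →L[𝕜] F :=
    ((InnerProductSpace.toDual 𝕜 F).symm.toContinuousLinearEquiv :
      StrongDual 𝕜 F →L⋆[𝕜] F).comp β'
  refine ⟨T', fun h k => ?_⟩
  have hT' : inner 𝕜 (T' k) h = B k h :=
    InnerProductSpace.toDual_symm_apply (x := h) (y := β' k)
  have := (RCLike.continuous_conj.tendsto (B k h)).comp (hlim k h)
  rw [← hT', inner_conj_symm] at this
  simpa only [Function.comp_def, inner_conj_symm] using this

end WeakLimit

/-! ### Maximal common minorants -/

section Disjoint

variable {𝕜 : Type*} [RCLike 𝕜] {Y : Type u} {G : Y → Type w}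
  [∀ y, NormedAddCommGroup (G y)] [∀ y, InnerProductSpace 𝕜 (G y)]

theorem tendsto_sectionForm {ι : Type*} {l : Filter ι} {T : ι → OpKernel 𝕜 G} {L : OpKernel 𝕜 G}
    (hT : ∀ x y h k, Tendsto (fun i => inner 𝕜 h (T i x y k)) l (𝓝 (inner 𝕜 h (L x y k))))
    (f g : Π₀ y, G y) :
    Tendsto (fun i => sectionForm (T i) f g) l (𝓝 (sectionForm L f g)) := by
  classical
  simp only [sectionForm_eq_sum _ f g subset_rfl subset_rfl]
  exact tendsto_finsetSum _ fun x _ => tendsto_finsetSum _ fun y _ => hT _ _ _ _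

variable [∀ y, CompleteSpace (G y)]

namespace IsPosSemidefKernel

/-- Weak limits of positive semidefinite kernels are positive semidefinite. -/
theorem of_tendsto {ι : Type*} {l : Filter ι} [l.NeBot] {T : ι → OpKernel 𝕜 G}
    {L : OpKernel 𝕜 G}
    (hT : ∀ x y h k, Tendsto (fun i => inner 𝕜 h (T i x y k)) l (𝓝 (inner 𝕜 h (L x y k))))
    (hpos : ∀ᶠ i in l, IsPosSemidefKernel (T i)) : IsPosSemidefKernel L := by
  refine ⟨fun x y => ?_, fun f => ?_⟩
  · refine ContinuousLinearMap.ext fun h => ext_inner_left 𝕜 fun k => ?_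
    rw [ContinuousLinearMap.adjoint_inner_right, ← inner_conj_symm]
    refine tendsto_nhds_unique_of_eventuallyEq
      ((RCLike.continuous_conj.tendsto _).comp (hT x y h k)) (hT y x k h) ?_
    filter_upwards [hpos] with i hi
    rw [Function.comp_apply, inner_conj_symm, ← hi.hermitian x y,
      ContinuousLinearMap.adjoint_inner_right]
  · exact ge_of_tendsto ((RCLike.continuous_re.tendsto _).comp (tendsto_sectionForm hT f f))
      (hpos.mono fun i hi => hi.nonneg f)

/-- Antisymmetry of the order: `M` is dominated by the zero kernel, whose diagonal bounds every
entry of `M` by zero. -/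
theorem eq_zero_of_neg {M : OpKernel 𝕜 G} (hM : IsPosSemidefKernel M)
    (hM' : IsPosSemidefKernel (-M)) : M = 0 := by
  funext x y
  have h := hM.norm_apply_le (K := 0) (by rwa [zero_sub]) x y
  simpa using h

/-- Two positive semidefinite kernels become disjoint after subtracting a suitable common
minorant. -/
theorem exists_maximal_minorant {K₁ K₂ : OpKernel 𝕜 G} (h₁ : IsPosSemidefKernel K₁)
    (h₂ : IsPosSemidefKernel K₂) :
    ∃ L : OpKernel 𝕜 G, IsPosSemidefKernel L ∧ IsPosSemidefKernel (K₁ - L) ∧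
      IsPosSemidefKernel (K₂ - L) ∧
      ∀ M : OpKernel 𝕜 G, IsPosSemidefKernel M → IsPosSemidefKernel (K₁ - L - M) →
        IsPosSemidefKernel (K₂ - L - M) → M = 0 := by
  let α := {L : OpKernel 𝕜 G // IsPosSemidefKernel L ∧ IsPosSemidefKernel (K₁ - L) ∧
    IsPosSemidefKernel (K₂ - L)}
  let _ : Preorder α :=
    { le := fun L M => IsPosSemidefKernel (M.1 - L.1)
      le_refl := fun L => by rw [sub_self]; exact zero
      le_trans := fun L M N hLM hMN => by
        have := hLM.add hMN
        rwa [sub_add_sub_cancel'] at this }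
  have : Nonempty α := ⟨⟨0, zero, by rwa [sub_zero], by rwa [sub_zero]⟩⟩
  obtain ⟨m, hm⟩ : ∃ m : α, IsMax m := by
    refine zorn_le_nonempty fun c hc hne => ?_
    have : Nonempty c := hne.to_subtype
    have : IsDirectedOrder c := ⟨fun a b => by
      rcases hc.total a.2 b.2 with h | h
      · exact ⟨b, h, le_rfl⟩
      · exact ⟨a, le_rfl, h⟩⟩
    -- Refining `atTop` on the chain makes the weak limit an upper bound: eventually every member of
    -- the chain dominates the given `N`.
    let U : Ultrafilter c := Ultrafilter.of atTop
    have lim : ∀ x y, ∃ T : G y →L[𝕜] G x, ∀ h k,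
        Tendsto (fun L : c => inner 𝕜 h (L.1.1 x y k)) U (𝓝 (inner 𝕜 h (T k))) := fun x y =>
      exists_tendsto_inner_of_norm_le U (fun L : c => L.1.1 x y)
        fun L => norm_apply_le L.1.2.1 L.1.2.2.1 x y
    choose T hT using lim
    have hsub : ∀ (N : OpKernel 𝕜 G) (x y h k),
        Tendsto (fun L : c => inner 𝕜 h ((N - L.1.1) x y k)) U
          (𝓝 (inner 𝕜 h ((N - T) x y k))) := fun N x y h k => by
      simpa only [Pi.sub_apply, sub_apply, inner_sub_right] using
        tendsto_const_nhds.sub (hT x y h k)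
    refine ⟨⟨T, of_tendsto hT (.of_forall fun L => L.1.2.1),
      of_tendsto (hsub K₁) (.of_forall fun L => L.1.2.2.1),
      of_tendsto (hsub K₂) (.of_forall fun L => L.1.2.2.2)⟩, fun N hN => ?_⟩
    refine of_tendsto (l := (U : Filter c)) (T := fun L : c => L.1.1 - N.1)
      (fun x y h k => ?_) ?_
    · simpa only [Pi.sub_apply, sub_apply, inner_sub_right] using
        (hT x y h k).sub tendsto_const_nhds
    · exact Ultrafilter.of_le atTop (eventually_ge_atTop (⟨N, hN⟩ : c))
  refine ⟨m.1, m.2.1, m.2.2.1, m.2.2.2, fun M hM hM₁ hM₂ => ?_⟩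
  -- `m + M` is again a common minorant above `m`, so maximality gives `m + M ≤ m`.
  refine hM.eq_zero_of_neg ?_
  have := hm (b := ⟨m.1 + M, m.2.1.add hM, by rwa [← sub_sub], by rwa [← sub_sub]⟩)
    (show IsPosSemidefKernel (m.1 + M - m.1) by rwa [add_sub_cancel_left])
  have h : IsPosSemidefKernel (m.1 - (m.1 + M)) := this
  rwa [sub_add_cancel_left] at h

end IsPosSemidefKernel

end Disjoint

/-! ### Krein spaces through a fundamental symmetry -/

section KreinModel

variable {𝕜 E : Type*} [RCLike 𝕜] [AddCommGroup E] [Module 𝕜 E]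

/-- A Hilbert space with a symmetric involution models a Krein space. -/
theorem isKreinSpace_of_linearEquiv {M : Type*} [NormedAddCommGroup M] [InnerProductSpace 𝕜 M]
    [CompleteSpace M] (J : M →ₗ[𝕜] M) (hJ : ∀ m, J (J m) = m) (e : E ≃ₗ[𝕜] M)
    (b : IndefiniteInner 𝕜 E) (hb : ∀ f g, b.ip f g = inner 𝕜 (e g) (J (e f))) :
    IsKreinSpace b := by
  let c : InnerProductSpace.Core 𝕜 E :=
    { inner := fun f g => inner 𝕜 (e f) (e g)
      conj_inner_symm := fun f g => inner_conj_symm _ _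
      re_inner_nonneg := fun f => inner_self_nonneg
      add_left := fun f g k => by simp only [map_add, inner_add_left]
      smul_left := fun f g a => by simp only [map_smul, inner_smul_left]
      definite := fun f hf => by simpa using hf }
  refine ⟨⟨e.symm.toLinearMap ∘ₗ J ∘ₗ e.toLinearMap, fun x => by simp [hJ], c,
    fun x y => ?_, ?_⟩⟩
  · simp only [hb, LinearMap.comp_apply, LinearEquiv.coe_coe, LinearEquiv.apply_symm_apply, hJ]
    rfl
  · let _ : NormedAddCommGroup E := c.toNormedAddCommGroup
    have hnorm : ∀ f : E, ‖e f‖ = ‖f‖ := fun f => (norm_eq_sqrt_re_inner (𝕜 := 𝕜) (e f))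
    have hiso : Isometry e := AddMonoidHomClass.isometry_of_norm e hnorm
    exact (hiso.isUniformInducing.completeSpace_congr e.surjective).2 inferInstance

namespace FundamentalSymmetry

variable {b : IndefiniteInner 𝕜 E} (F : FundamentalSymmetry b)

theorem ip_eq_inner (x y : E) : b.ip x y = F.core.inner y (F.J x) := by
  rw [F.inner_eq, F.J_J]

/-- An operator into a Krein space with an everywhere defined adjoint is bounded. -/
theorem exists_norm_le_of_adjoint {H : Type*} [NormedAddCommGroup H] [InnerProductSpace 𝕜 H]
    [CompleteSpace H] (V : H →ₗ[𝕜] E) (W : E → H)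
    (hVW : ∀ f h, inner 𝕜 h (W f) = b.ip f (V h)) :
    ∃ C : ℝ, ∀ h, F.norm (V h) ≤ C * ‖h‖ := by
  let _ : NormedAddCommGroup E := F.core.toNormedAddCommGroup
  let _ : InnerProductSpace 𝕜 E := .ofCore F.core.toCore
  have _ : CompleteSpace E := F.complete
  have hinner : ∀ h f, inner 𝕜 (V h) f = inner 𝕜 h (W (F.J f)) := fun h f => by
    rw [hVW]; exact F.inner_eq f (V h)
  let V' : H →L[𝕜] E := ContinuousLinearMap.ofSeqClosedGraph (g := V) <| by
    -- Closed graph: `y` and `V x` are compared by pairing with every `f`, since `⟨V h, f⟩ = ⟨h, W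
    -- (J f)⟩` is continuous in `h`.
    intro u x y hu hVu
    refine ext_inner_right 𝕜 fun f => ?_
    rw [hinner]
    refine tendsto_nhds_unique ((hVu.inner tendsto_const_nhds).congr fun n => hinner _ _) ?_
    exact hu.inner tendsto_const_nhds
  exact ⟨‖V'‖, fun h => V'.le_opNorm h⟩

/-- A set with trivial `[·,·]`-orthogonal companion is total in the strong topology. -/
theorem dense_span_of_ip (A : Set E) (hA : ∀ f, (∀ g ∈ A, b.ip f g = 0) → f = 0) :
    @Dense E F.strongTopology (Submodule.span 𝕜 A : Set E) := by
  let _ : NormedAddCommGroup E := F.core.toNormedAddCommGroup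
  let _ : InnerProductSpace 𝕜 E := .ofCore F.core.toCore
  have _ : CompleteSpace E := F.complete
  have h : Dense (Submodule.span 𝕜 A : Set E) := by
    rw [Submodule.dense_iff_topologicalClosure_eq_top, Submodule.topologicalClosure_eq_top_iff,
      Submodule.eq_bot_iff]
    intro f hf
    -- Hilbert orthogonality of `f` to `A` is `[·,·]`-orthogonality of `J f` to `A`.
    have hJ : F.J f = 0 := hA _ fun g hg => by
      rw [← F.inner_eq]
      exact hf g (Submodule.subset_span hg)
    rw [← F.J_J f, hJ, map_zero]
  exact h

/-- A kernel that factors through a Krein space is dominated by a positive semidefinite kernel. -/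
theorem exists_dominating {Y : Type u} {G : Y → Type w} [∀ y, NormedAddCommGroup (G y)]
    [∀ y, InnerProductSpace 𝕜 (G y)] [∀ y, CompleteSpace (G y)] {K : OpKernel 𝕜 G}
    (hK : ∀ x y, ContinuousLinearMap.adjoint (K x y) = K y x) (V : ∀ y, G y →ₗ[𝕜] E)
    (hbd : ∀ y, ∃ C : ℝ, ∀ h, F.norm (V y h) ≤ C * ‖h‖)
    (hV : ∀ x y h k, inner 𝕜 h (K x y k) = b.ip (V y k) (V x h)) :
    ∃ L : OpKernel 𝕜 G, IsPosSemidefKernel L ∧ IsPosSemidefKernel (L - K) := by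
  classical
  let _ : NormedAddCommGroup E := F.core.toNormedAddCommGroup
  let _ : InnerProductSpace 𝕜 E := .ofCore F.core.toCore
  have _ : CompleteSpace E := F.complete
  choose C hC using hbd
  let V' : ∀ y, G y →L[𝕜] E := fun y => (V y).mkContinuous (C y) (hC y)
  let L : OpKernel 𝕜 G := fun x y => (ContinuousLinearMap.adjoint (V' x)).comp (V' y)
  have hL : ∀ x y h k, inner 𝕜 (V x h) (LinearMap.id (R := 𝕜) (V y k)) = inner 𝕜 h (L x y k) :=
    fun x y h k => (ContinuousLinearMap.adjoint_inner_right (V' x) h (V' y k)).symm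
  have hip : ∀ x y : E, inner 𝕜 y (F.J x) = b.ip x y := fun x y => (F.ip_eq_inner x y).symm
  have hsymm : ∀ x y : E, inner 𝕜 (F.J x) y = inner 𝕜 x (F.J y) := fun x y => by
    rw [hip, ← inner_conj_symm, hip, b.conj_symm]
  have hLadj : ∀ x y, ContinuousLinearMap.adjoint (L x y) = L y x := fun x y => by
    simp only [L, ContinuousLinearMap.adjoint_comp, ContinuousLinearMap.adjoint_adjoint]
  refine ⟨L, ⟨hLadj, fun f => ?_⟩, ⟨fun x y => ?_, fun f => ?_⟩⟩
  · rw [sectionForm_eq_inner V LinearMap.id hL]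
    exact inner_self_nonneg
  · rw [Pi.sub_apply, Pi.sub_apply, map_sub, hLadj, hK]; rfl
  · rw [sectionForm_sub, sectionForm_eq_inner V LinearMap.id hL,
      sectionForm_eq_inner V F.J (fun x y h k => by rw [hip, hV])]
    set m := ∑ x ∈ f.support, V x (f x)
    -- As `J` is symmetric and `J² = I`, `‖m - J m‖² = 2 (⟨m, m⟩ - ⟨m, J m⟩)`, twice the form of `L
    -- - K`.
    have h1 : 0 ≤ RCLike.re (inner 𝕜 (m - F.J m) (m - F.J m)) := inner_self_nonneg
    have h2 : inner 𝕜 (F.J m) (F.J m) = inner 𝕜 m m := by rw [hsymm, F.J_J]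
    rw [inner_sub_left, inner_sub_right, inner_sub_right, h2, hsymm] at h1
    simp only [map_sub] at h1
    rw [LinearMap.id_apply, map_sub]
    linarith

end FundamentalSymmetry

end KreinModel

/-! ### Rank one minorants and reproducing kernel Krein spaces -/

section ReproducingKernel

variable {𝕜 : Type*} [RCLike 𝕜]

section RankOne

variable {Y : Type u} {G : Y → Type w} [∀ y, NormedAddCommGroup (G y)]
  [∀ y, InnerProductSpace 𝕜 (G y)]

/-- The kernel `c f(x) ⟨f(y), ·⟩` attached to a section `f`. -/
noncomputable def rankOneKernel (c : ℝ) (f : ∀ y, G y) : OpKernel 𝕜 G :=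
  fun x y => (c : 𝕜) • InnerProductSpace.rankOne 𝕜 (f x) (f y)

theorem sectionForm_rankOneKernel (c : ℝ) (f : ∀ y, G y) (g : Π₀ y, G y) [DecidableEq Y]
    [∀ y (v : G y), Decidable (v ≠ 0)] :
    RCLike.re (sectionForm (rankOneKernel c f : OpKernel 𝕜 G) g g) =
      c * ‖∑ y ∈ g.support, inner 𝕜 (f y) (g y)‖ ^ 2 := by
  rw [sectionForm_eq_inner (E := 𝕜) (fun y => (innerSL 𝕜 (f y)).toLinearMap)
    ((c : 𝕜) • LinearMap.id) fun x y h k => by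
      simp [rankOneKernel, inner_smul_right, RCLike.real_smul_eq_coe_mul, mul_comm,
        mul_assoc]]
  simp only [LinearMap.smul_apply, LinearMap.id_apply, inner_smul_right, RCLike.re_ofReal_mul,
    inner_self_eq_norm_sq]
  congr!

variable [∀ y, CompleteSpace (G y)]

theorem adjoint_rankOneKernel (c : ℝ) (f : ∀ y, G y) (x y : Y) :
    ContinuousLinearMap.adjoint ((rankOneKernel c f : OpKernel 𝕜 G) x y) =
      rankOneKernel c f y x := by
  simp [rankOneKernel, map_smulₛₗ]

theorem isPosSemidefKernel_rankOneKernel {c : ℝ} (hc : 0 ≤ c) (f : ∀ y, G y) :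
    IsPosSemidefKernel (rankOneKernel c f : OpKernel 𝕜 G) := by
  classical
  exact ⟨adjoint_rankOneKernel c f, fun g => by rw [sectionForm_rankOneKernel]; positivity⟩

/-- The sections in the range of the adjoint factorisation give small rank one minorants. -/
theorem IsPosSemidefKernel.sub_rankOneKernel {K : OpKernel 𝕜 G} (hK : IsPosSemidefKernel K)
    {M : Type*} [NormedAddCommGroup M] [InnerProductSpace 𝕜 M] [CompleteSpace M]
    {V : ∀ y, G y →L[𝕜] M} (hV : ∀ x y h k, inner 𝕜 (V x h) (V y k) = inner 𝕜 h (K x y k))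
    {c : ℝ} (hc : 0 ≤ c) {m : M} (hm : c * ‖m‖ ^ 2 ≤ 1) {f : ∀ y, G y}
    (hf : ∀ y, f y = ContinuousLinearMap.adjoint (V y) m) :
    IsPosSemidefKernel (K - rankOneKernel c f) := by
  classical
  refine ⟨fun x y => ?_, fun g => ?_⟩
  · rw [Pi.sub_apply, Pi.sub_apply, map_sub, hK.hermitian, adjoint_rankOneKernel]; rfl
  · rw [sectionForm_sub, map_sub, sectionForm_rankOneKernel,
      sectionForm_eq_inner (fun y => (V y).toLinearMap) LinearMap.id hV]
    simp only [LinearMap.id_apply, inner_self_eq_norm_sq, hf,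
      ContinuousLinearMap.adjoint_inner_left, ContinuousLinearMap.coe_coe, ← inner_sum]
    -- The form of `K` at `g` is `‖n‖²`, and `c |⟨m, n⟩|² ≤ c ‖m‖² ‖n‖² ≤ ‖n‖²`.
    set n := ∑ y ∈ g.support, V y (g y)
    have h1 : ‖inner 𝕜 m n‖ ^ 2 ≤ ‖m‖ ^ 2 * ‖n‖ ^ 2 := by
      rw [← mul_pow]; gcongr; exact norm_inner_le_norm _ _
    have h2 : c * ‖inner 𝕜 m n‖ ^ 2 ≤ c * (‖m‖ ^ 2 * ‖n‖ ^ 2) := by gcongr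
    nlinarith [sq_nonneg ‖n‖]

end RankOne

variable {X : Type u} {H : X → Type w} [∀ x, NormedAddCommGroup (H x)]
  [∀ x, InnerProductSpace 𝕜 (H x)]

/-- The restriction of a kernel to a subset. -/
def restrictKernel (A : Set X) (K : OpKernel 𝕜 H) : OpKernel 𝕜 fun x : A => H x :=
  fun x y => K x y

namespace IsReproducingKernelKreinSpace

variable {A : Set X} {K : OpKernel 𝕜 H} {R : Submodule 𝕜 (∀ x : A, H x)}
  {b : IndefiniteInner 𝕜 R}

/-- The operator `h ↦ K(·, x) h` into a reproducing kernel Krein space. -/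
def kernelMap (hR : IsReproducingKernelKreinSpace A K R b) (x : A) : H x →ₗ[𝕜] R where
  toFun h := ⟨fun y => K y x h, hR.kernel_mem x h⟩
  map_add' h k := Subtype.ext (funext fun y => map_add (K y x) h k)
  map_smul' a h := Subtype.ext (funext fun y => map_smul (K y x) a h)

/-- The reproducing property makes every value of `f` orthogonal to its fibre. This is the input for
`dense_span_of_ip`. -/
theorem eq_zero_of_ip_kernelMap (hR : IsReproducingKernelKreinSpace A K R b) {f : R}
    (hf : ∀ x h, b.ip f (hR.kernelMap x h) = 0) : f = 0 :=
  Subtype.ext <| funext fun x => ext_inner_left 𝕜 fun h =>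
    ((hR.reproducing f x h).trans (hf x h)).trans (inner_zero_right _).symm

end IsReproducingKernelKreinSpace

variable [∀ x, CompleteSpace (H x)]

/-- The difference of two disjoint positive semidefinite kernels reproduces a Krein space. -/
theorem exists_isReproducingKernelKreinSpace {A : Set X} {K₁ K₂ : OpKernel 𝕜 H}
    (h₁ : IsPosSemidefKernel (restrictKernel A K₁))
    (h₂ : IsPosSemidefKernel (restrictKernel A K₂))
    (hdisj : ∀ M, IsPosSemidefKernel M → IsPosSemidefKernel (restrictKernel A K₁ - M) →
      IsPosSemidefKernel (restrictKernel A K₂ - M) → M = 0) :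
    ∃ (R : Submodule 𝕜 (∀ x : A, H x)) (b : IndefiniteInner 𝕜 R),
      IsReproducingKernelKreinSpace A (K₁ - K₂) R b := by
  obtain ⟨M₁, _, _, _, V₁, hV₁, ht₁⟩ := h₁.exists_factorisation
  obtain ⟨M₂, _, _, _, V₂, hV₂, ht₂⟩ := h₂.exists_factorisation
  let Φ : WithLp 2 (M₁ × M₂) →ₗ[𝕜] ∀ x : A, H x := LinearMap.pi fun x =>
    (ContinuousLinearMap.adjoint (V₁ x)).toLinearMap ∘ₗ WithLp.fstₗ 2 𝕜 M₁ M₂ +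
      (ContinuousLinearMap.adjoint (V₂ x)).toLinearMap ∘ₗ WithLp.sndₗ 2 𝕜 M₁ M₂
  have hΦ : ∀ m x, Φ m x = ContinuousLinearMap.adjoint (V₁ x) m.fst +
      ContinuousLinearMap.adjoint (V₂ x) m.snd := fun m x => rfl
  have hker : ∀ m, Φ m = 0 → m = 0 := by
    intro m hm
    set f : ∀ x : A, H x := fun x => ContinuousLinearMap.adjoint (V₁ x) m.fst with hf
    have hf₂ : ∀ x, f x = ContinuousLinearMap.adjoint (V₂ x) (-m.snd) := fun x => by
      rw [map_neg, eq_neg_iff_add_eq_zero, ← hΦ, hm]; rfl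
    -- One constant with `c ‖m.fst‖² ≤ 1` and `c ‖m.snd‖² ≤ 1`, as both domination claims require;
    -- the `+ 1` keeps the denominator positive.
    set c : ℝ := (‖m.fst‖ ^ 2 + ‖m.snd‖ ^ 2 + 1)⁻¹ with hc
    have hpos : 0 < ‖m.fst‖ ^ 2 + ‖m.snd‖ ^ 2 + 1 := by positivity
    have hc0 : 0 < c := inv_pos.2 hpos
    have hzero := hdisj _ (isPosSemidefKernel_rankOneKernel hc0.le f)
      (h₁.sub_rankOneKernel hV₁ hc0.le (by rw [hc, inv_mul_le_one₀ hpos]; nlinarith)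
        fun x => rfl)
      (h₂.sub_rankOneKernel hV₂ hc0.le
        (by rw [hc, inv_mul_le_one₀ hpos, norm_neg]; nlinarith) hf₂)
    -- The diagonal entry of the rank one kernel at `f x` is `c ‖f x‖² f x`.
    have hf0 : ∀ x, f x = 0 := fun x => by
      have h : (rankOneKernel c f : OpKernel 𝕜 fun x : A => H x) x x (f x) = 0 := by
        rw [hzero]; rfl
      simpa [rankOneKernel, hc0.ne'] using h
    have hm₁ : m.fst = 0 := ht₁ _ fun x h => by
      rw [← ContinuousLinearMap.adjoint_inner_right]
      exact (congrArg _ (hf0 x)).trans (inner_zero_right _)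
    have hm₂ : m.snd = 0 := by
      rw [← neg_eq_zero]
      refine ht₂ _ fun x h => ?_
      rw [← ContinuousLinearMap.adjoint_inner_right, ← hf₂, hf0, inner_zero_right]
    exact WithLp.ofLp_injective 2 (Prod.ext hm₁ hm₂)
  let e : WithLp 2 (M₁ × M₂) ≃ₗ[𝕜] LinearMap.range Φ :=
    LinearEquiv.ofInjective Φ ((injective_iff_map_eq_zero Φ).2 hker)
  let J : WithLp 2 (M₁ × M₂) →ₗ[𝕜] WithLp 2 (M₁ × M₂) :=
    { toFun := fun m => WithLp.toLp 2 (m.fst, -m.snd)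
      map_add' := fun m n => WithLp.ofLp_injective 2 (Prod.ext rfl (neg_add _ _))
      map_smul' := fun a m => WithLp.ofLp_injective 2 (Prod.ext rfl (smul_neg _ _).symm) }
  have hip : ∀ m n, inner 𝕜 n (J m) = inner 𝕜 n.fst m.fst - inner 𝕜 n.snd m.snd := by
    intro m n
    rw [WithLp.prod_inner_apply, sub_eq_add_neg, ← inner_neg_right]
    rfl
  let b : IndefiniteInner 𝕜 (LinearMap.range Φ) :=
    { ip := fun f g => inner 𝕜 (e.symm g) (J (e.symm f))
      add_left := fun f g k => by simp only [map_add, inner_add_right]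
      smul_left := fun a f g => by simp only [map_smul, inner_smul_right]
      conj_symm := fun f g => by simp only [hip, map_sub, inner_conj_symm] }
  -- The sign on `V₂` produces `K₁ - K₂`; in the reproducing identity it cancels against the sign of
  -- `J`.
  have hmem : ∀ (x : A) (h : H x), (fun y : A => (K₁ - K₂) y x h) =
      Φ (WithLp.toLp 2 (V₁ x h, -V₂ x h)) := by
    intro x h
    funext y
    have e₁ : ContinuousLinearMap.adjoint (V₁ y) (V₁ x h) = K₁ y x h :=
      ext_inner_left 𝕜 fun k => by
        rw [ContinuousLinearMap.adjoint_inner_right, hV₁]; rfl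
    have e₂ : ContinuousLinearMap.adjoint (V₂ y) (V₂ x h) = K₂ y x h :=
      ext_inner_left 𝕜 fun k => by
        rw [ContinuousLinearMap.adjoint_inner_right, hV₂]; rfl
    rw [hΦ]
    change _ = ContinuousLinearMap.adjoint (V₁ y) (V₁ x h) +
      ContinuousLinearMap.adjoint (V₂ y) (-V₂ x h)
    rw [map_neg, e₁, e₂, ← sub_eq_add_neg]
    rfl
  refine ⟨LinearMap.range Φ, b, isKreinSpace_of_linearEquiv J (fun m => ?_) e.symm b
    (fun f g => rfl), fun x h => ⟨_, (hmem x h).symm⟩, fun f x h => ?_⟩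
  · exact WithLp.ofLp_injective 2 (Prod.ext rfl (neg_neg _))
  · obtain ⟨m, rfl⟩ := e.surjective f
    have hK : (⟨fun y : A => (K₁ - K₂) y x h, ⟨_, (hmem x h).symm⟩⟩ : LinearMap.range Φ) =
        e (WithLp.toLp 2 (V₁ x h, -V₂ x h)) := Subtype.ext (hmem x h)
    change inner 𝕜 h (Φ m x) = inner 𝕜 (e.symm _) (J (e.symm (e m)))
    rw [hK, e.symm_apply_apply, e.symm_apply_apply, hip, hΦ, inner_add_right,
      ContinuousLinearMap.adjoint_inner_right, ContinuousLinearMap.adjoint_inner_right]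
    change _ = inner 𝕜 (V₁ x h) m.fst - inner 𝕜 (-V₂ x h) m.snd
    rw [inner_neg_left, sub_neg_eq_add]

end ReproducingKernel

/-! ### From single blocks to the partition -/

section Partition

variable {𝕜 : Type*} [RCLike 𝕜] {X : Type u} {S : Type v} {H : X → Type w}
  [∀ x, NormedAddCommGroup (H x)] [∀ x, InnerProductSpace 𝕜 (H x)] {P : S → Set X}

/-- The kernel with prescribed restrictions to the blocks of a partition that vanishes outside
the blocks. -/
noncomputable def IndexedPartition.glueKernel (hP : IndexedPartition P)
    (F : ∀ s, OpKernel 𝕜 fun x : P s => H x) : OpKernel 𝕜 H := fun x y =>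
  open Classical in
  if h : hP.index y = hP.index x then
    F (hP.index x) ⟨x, hP.mem_index x⟩ ⟨y, hP.mem_iff_index_eq.2 h⟩
  else 0

theorem IndexedPartition.restrictKernel_glueKernel (hP : IndexedPartition P)
    (F : ∀ s, OpKernel 𝕜 fun x : P s => H x) (s : S) :
    restrictKernel (P s) (hP.glueKernel F) = F s := by
  funext ⟨x, hx⟩ ⟨y, hy⟩
  have hx' := hP.mem_iff_index_eq.1 hx
  have hy' := hP.mem_iff_index_eq.1 hy
  subst hx'
  simp only [restrictKernel, IndexedPartition.glueKernel, dif_pos hy']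

theorem kernelForm_eq_sectionForm (K : OpKernel 𝕜 H) (A : Set X) (f g : Π₀ x : A, H x) :
    kernelForm A K f g = sectionForm (restrictKernel A K) f g := by
  rw [kernelForm, sectionForm]
  congr!

variable [∀ x, CompleteSpace (H x)]

/-- Bridge between sums over finite sequences, whose points may repeat, and forms on sections of
finite support. -/
theorem isPartiallyPosSemidef_iff {K : OpKernel 𝕜 H} :
    IsPartiallyPosSemidef P K ↔ ∀ s, IsPosSemidefKernel (restrictKernel (P s) K) := by
  classical
  refine ⟨fun h s => ⟨fun x y => h.1 s x x.2 y y.2, fun f => ?_⟩,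
    fun h => ⟨fun s x hx y hy => (h s).hermitian ⟨x, hx⟩ ⟨y, hy⟩, fun s n x k => ?_⟩⟩
  · obtain ⟨t, ht⟩ : ∃ t : Finset (P s), sectionForm (restrictKernel (P s) K) f f =
        ∑ x ∈ t, ∑ y ∈ t, inner 𝕜 (f y) (K y x (f x)) :=
      ⟨_, sectionForm_eq_sum _ f f subset_rfl subset_rfl⟩
    have key := h.2 s _ (fun i => (t.equivFin.symm i).1) fun i => f (t.equivFin.symm i).1
    rw [ht]
    simp only [← Finset.sum_coe_sort t, ← t.equivFin.symm.sum_comp]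
    exact key
  -- Through the factorisation the double sum is `‖∑ V (x i) (k i)‖²`, so repeated points need no
  -- regrouping.
  · obtain ⟨M, _, _, _, V, hV, -⟩ := (h s).exists_factorisation
    have key : ∑ i, ∑ j, inner 𝕜 (k j) (K (x j) (x i) (k i)) =
        inner 𝕜 (∑ j, V (x j) (k j)) (∑ i, V (x i) (k i)) := by
      rw [inner_sum]
      refine Finset.sum_congr rfl fun i _ => ?_
      rw [sum_inner]
      exact Finset.sum_congr rfl fun j _ => (hV _ _ _ _).symm
    rw [key]
    exact inner_self_nonneg

namespace IsPartiallyPosSemidef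

variable {K L K₁ K₂ : OpKernel 𝕜 H}

theorem add (hK : IsPartiallyPosSemidef P K) (hL : IsPartiallyPosSemidef P L) :
    IsPartiallyPosSemidef P (K + L) :=
  isPartiallyPosSemidef_iff.2 fun s =>
    (isPartiallyPosSemidef_iff.1 hK s).add (isPartiallyPosSemidef_iff.1 hL s)

/-- A difference of positive semidefinite kernels is a difference of disjoint ones. -/
theorem exists_disjoint (hP : IndexedPartition P) (h₁ : IsPartiallyPosSemidef P K₁)
    (h₂ : IsPartiallyPosSemidef P K₂) :
    ∃ L : OpKernel 𝕜 H, IsPartiallyPosSemidef P (K₁ - L) ∧ IsPartiallyPosSemidef P (K₂ - L) ∧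
      PartiallyDisjoint P (K₁ - L) (K₂ - L) := by
  rw [isPartiallyPosSemidef_iff] at h₁ h₂
  choose F _ hF₁ hF₂ hF using fun s => (h₁ s).exists_maximal_minorant (h₂ s)
  have hL := hP.restrictKernel_glueKernel F
  have hsub : ∀ (N : OpKernel 𝕜 H) s,
      restrictKernel (P s) (N - hP.glueKernel F) = restrictKernel (P s) N - F s :=
    fun N s => (congrArg (restrictKernel (P s) N - ·) (hL s) :)
  refine ⟨hP.glueKernel F, isPartiallyPosSemidef_iff.2 fun s => hsub _ s ▸ hF₁ s,
    isPartiallyPosSemidef_iff.2 fun s => hsub _ s ▸ hF₂ s,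
    fun M hM hM₁ hM₂ s x hx y hy => ?_⟩
  have hzero := hF s (restrictKernel (P s) M) (isPartiallyPosSemidef_iff.1 hM s)
    (hsub K₁ s ▸ isPartiallyPosSemidef_iff.1 hM₁ s)
    (hsub K₂ s ▸ isPartiallyPosSemidef_iff.1 hM₂ s)
  exact congrFun (congrFun hzero ⟨x, hx⟩) ⟨y, hy⟩

end IsPartiallyPosSemidef

/-- Cauchy–Schwarz for a kernel between `-L` and `L`. -/
theorem PartialLE.norm_kernelForm_le {K L : OpKernel 𝕜 H} (h₁ : PartialLE P (-L) K) (h₂ : PartialLE P K L) (s : S)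
    (f g : Π₀ x : P s, H x) :
    ‖kernelForm (P s) K f g‖ ≤
      √(RCLike.re (kernelForm (P s) L f f)) * √(RCLike.re (kernelForm (P s) L g g)) := by
  simp only [kernelForm_eq_sectionForm]
  set K' := restrictKernel (P s) K
  set L' := restrictKernel (P s) L
  have hA : IsPosSemidefKernel (K' + L') := by
    have h := isPartiallyPosSemidef_iff.1 h₁ s
    rwa [sub_neg_eq_add] at h
  have hB : IsPosSemidefKernel (L' - K') := isPartiallyPosSemidef_iff.1 h₂ s
  have hAf := hA.nonneg f
  have hAg := hA.nonneg g
  have hBf := hB.nonneg f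
  have hBg := hB.nonneg g
  have hAfg := hA.norm_sectionForm_le f g
  have hBfg := hB.norm_sectionForm_le f g
  have hsum : ∀ f, RCLike.re (sectionForm (K' + L') f f) + RCLike.re (sectionForm (L' - K') f f) =
      2 * RCLike.re (sectionForm L' f f) := fun f => by
    rw [sectionForm_add, sectionForm_sub, map_add, map_sub]; ring
  -- Polarity `2K = (K + L) - (L - K)` with both terms positive semidefinite.
  have hdiff : 2 * ‖sectionForm K' f g‖ ≤
      ‖sectionForm (K' + L') f g‖ + ‖sectionForm (L' - K') f g‖ := by
    have h : (2 : 𝕜) * sectionForm K' f g =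
        sectionForm (K' + L') f g - sectionForm (L' - K') f g := by
      rw [sectionForm_add, sectionForm_sub]; ring
    calc 2 * ‖sectionForm K' f g‖ = ‖(2 : 𝕜) * sectionForm K' f g‖ := by
          rw [norm_mul, RCLike.norm_ofNat]
      _ ≤ _ := h ▸ norm_sub_le _ _
  have hf := hsum f
  have hg := hsum g
  set a := RCLike.re (sectionForm (K' + L') f f)
  set a' := RCLike.re (sectionForm (K' + L') g g)
  set c := RCLike.re (sectionForm (L' - K') f f)
  set c' := RCLike.re (sectionForm (L' - K') g g)
  -- Cauchy–Schwarz in the plane for `(√a, √c)` and `(√a', √c')`. Since `a + c` and `a' + c'` are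
  -- twice the values of `L`, the resulting factor 2 cancels the one in `hdiff`.
  have hcs : √a * √a' + √c * √c' ≤ √(a + c) * √(a' + c') := by
    rw [← Real.sqrt_mul (add_nonneg hAf hBf)]
    refine Real.le_sqrt_of_sq_le ?_
    nlinarith [sq_nonneg (√a * √c' - √c * √a'), Real.sq_sqrt hAf, Real.sq_sqrt hAg,
      Real.sq_sqrt hBf, Real.sq_sqrt hBg,
      congrArg₂ (· * ·) (Real.sq_sqrt hAf) (Real.sq_sqrt hAg),
      congrArg₂ (· * ·) (Real.sq_sqrt hAf) (Real.sq_sqrt hBg),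
      congrArg₂ (· * ·) (Real.sq_sqrt hBf) (Real.sq_sqrt hAg),
      congrArg₂ (· * ·) (Real.sq_sqrt hBf) (Real.sq_sqrt hBg)]
  rw [hf, hg, Real.sqrt_mul zero_le_two, Real.sqrt_mul zero_le_two, mul_mul_mul_comm,
    Real.mul_self_sqrt zero_le_two] at hcs
  linarith

/-- Disjointness passes to the blocks of a partition. -/
theorem PartiallyDisjoint.restrictKernel {K₁ K₂ : OpKernel 𝕜 H} (hP : IndexedPartition P)
    (h₁ : IsPartiallyPosSemidef P K₁) (h₂ : IsPartiallyPosSemidef P K₂)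
    (hd : PartiallyDisjoint P K₁ K₂) (s : S) (M : OpKernel 𝕜 fun x : P s => H x)
    (hM : IsPosSemidefKernel M) (hM₁ : IsPosSemidefKernel (restrictKernel (P s) K₁ - M))
    (hM₂ : IsPosSemidefKernel (restrictKernel (P s) K₂ - M)) : M = 0 := by
  classical
  -- Disjointness is tested on kernels over all of `X`, so `M` is extended by zero on the other
  -- blocks, where `K₁` and `K₂` dominate zero.
  let F : ∀ t, OpKernel 𝕜 fun x : P t => H x := Function.update (fun _ => 0) s M
  have hFs : F s = M := Function.update_self ..
  have hFt : ∀ t, t ≠ s → F t = 0 := fun t ht => Function.update_of_ne ht ..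
  have hL := hP.restrictKernel_glueKernel F
  have hLE : ∀ N : OpKernel 𝕜 H, IsPartiallyPosSemidef P N →
      IsPosSemidefKernel (_root_.restrictKernel (P s) N - M) →
      PartialLE P (hP.glueKernel F) N := by
    refine fun N hN hNM => isPartiallyPosSemidef_iff.2 fun t => ?_
    change IsPosSemidefKernel (_root_.restrictKernel (P t) N -
      _root_.restrictKernel (P t) (hP.glueKernel F))
    rw [hL]
    by_cases ht : t = s
    · subst ht
      rwa [hFs]
    · rw [hFt t ht, sub_zero]
      exact isPartiallyPosSemidef_iff.1 hN t
  have hpos : IsPartiallyPosSemidef P (hP.glueKernel F) :=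
    isPartiallyPosSemidef_iff.2 fun t => by
      rw [hL]
      by_cases ht : t = s
      · subst ht
        rwa [hFs]
      · rw [hFt t ht]
        exact .zero
  have hzero := hd _ hpos (hLE K₁ h₁ hM₁) (hLE K₂ h₂ hM₂) s
  rw [← hFs, ← hL]
  funext x y
  exact hzero x x.2 y y.2

end Partition

/-! ### The equivalences -/

theorem theoremt {𝕜 : Type*} [RCLike 𝕜] {X : Type u} {S : Type v} (H : X → Type w)
    [∀ x, NormedAddCommGroup (H x)] [∀ x, InnerProductSpace 𝕜 (H x)]
    [∀ x, CompleteSpace (H x)]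
    (P : S → Set X) (hP : IndexedPartition P)
    (K : OpKernel 𝕜 H) (hK : IsPartiallyHermitian P K) :
    List.TFAE [
      -- (1)
      ∃ L : OpKernel 𝕜 H, IsPartiallyPosSemidef P L ∧ PartialLE P (-L) K ∧ PartialLE P K L,
      -- (1')
      ∃ L : OpKernel 𝕜 H, IsPartiallyPosSemidef P L ∧ PartialLE P K L,
      -- (2)
      ∃ L : OpKernel 𝕜 H, IsPartiallyPosSemidef P L ∧
        ∀ (s : S) (f g : Π₀ x : P s, H x),
          ‖kernelForm (P s) K f g‖ ≤
            Real.sqrt (RCLike.re (kernelForm (P s) L f f)) *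
              Real.sqrt (RCLike.re (kernelForm (P s) L g g)),
      -- (3)
      ∃ K₁ K₂ : OpKernel 𝕜 H, IsPartiallyPosSemidef P K₁ ∧ IsPartiallyPosSemidef P K₂ ∧
        K = K₁ - K₂,
      -- (3')
      ∃ K₁ K₂ : OpKernel 𝕜 H, IsPartiallyPosSemidef P K₁ ∧ IsPartiallyPosSemidef P K₂ ∧
        PartiallyDisjoint P K₁ K₂ ∧ K = K₁ - K₂,
      -- (4)
      ∃ Λ : KreinPartialLinearisation P K, Λ.IsMinimal,
      -- (5)
      ∃ (R : ∀ s : S, Submodule 𝕜 (∀ x : P s, H x)) (b : ∀ s : S, IndefiniteInner 𝕜 (R s)),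
        ∀ s : S, IsReproducingKernelKreinSpace (P s) K (R s) (b s)] := by
  tfae_have 1 → 2 := fun ⟨L, hL, _, h⟩ => ⟨L, hL, h⟩
  tfae_have 2 → 4 := fun ⟨L, hL, h⟩ => ⟨L, L - K, hL, h, (sub_sub_cancel L K).symm⟩
  tfae_have 4 → 1 := by
    rintro ⟨K₁, K₂, h₁, h₂, rfl⟩
    refine ⟨K₁ + K₂, h₁.add h₂, ?_, ?_⟩
    · have : K₁ - K₂ - -(K₁ + K₂) = K₁ + K₁ := by abel
      rw [PartialLE, this]
      exact h₁.add h₁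
    · have : K₁ + K₂ - (K₁ - K₂) = K₂ + K₂ := by abel
      rw [PartialLE, this]
      exact h₂.add h₂
  tfae_have 1 → 3 := fun ⟨L, hL, h₁, h₂⟩ =>
    ⟨L, hL, h₁.norm_kernelForm_le h₂⟩
  tfae_have 3 → 2 := by
    rintro ⟨L, hL, h⟩
    refine ⟨L, hL, isPartiallyPosSemidef_iff.2 fun s => ⟨fun x y => ?_, fun f => ?_⟩⟩
    · change ContinuousLinearMap.adjoint (L x y - K x y) = L y x - K y x
      rw [map_sub, hL.1 s x x.2 y y.2, hK s x x.2 y y.2]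
    · change 0 ≤ RCLike.re (sectionForm (restrictKernel (P s) L - restrictKernel (P s) K) f f)
      -- On the diagonal the two square roots multiply to the form of `L`.
      have hf := h s f f
      simp only [kernelForm_eq_sectionForm] at hf
      rw [Real.mul_self_sqrt ((isPartiallyPosSemidef_iff.1 hL s).nonneg f)] at hf
      rw [sectionForm_sub, map_sub, sub_nonneg]
      exact (RCLike.re_le_norm _).trans hf
  tfae_have 4 → 5 := by
    rintro ⟨K₁, K₂, h₁, h₂, rfl⟩
    obtain ⟨L, hL₁, hL₂, hL⟩ := IsPartiallyPosSemidef.exists_disjoint hP h₁ h₂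
    exact ⟨K₁ - L, K₂ - L, hL₁, hL₂, hL, (sub_sub_sub_cancel_right K₁ K₂ L).symm⟩
  tfae_have 5 → 7 := by
    rintro ⟨K₁, K₂, h₁, h₂, hd, rfl⟩
    choose R b hR using fun s => exists_isReproducingKernelKreinSpace
      (isPartiallyPosSemidef_iff.1 h₁ s) (isPartiallyPosSemidef_iff.1 h₂ s)
      (hd.restrictKernel hP h₁ h₂ s)
    exact ⟨R, b, hR⟩
  tfae_have 7 → 6 := by
    rintro ⟨R, b, hR⟩
    let F : ∀ s, FundamentalSymmetry (b s) := fun s => (hR s).isKrein.some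
    refine ⟨
      { space := fun s => R s
        form := b
        symmetry := F
        V := fun s => (hR s).kernelMap
        V_bounded := fun s x => (F s).exists_norm_le_of_adjoint _ (fun f => f.1 x)
          fun f h => (hR s).reproducing f x h
        factorisation := fun s x y h k =>
          (hR s).reproducing ((hR s).kernelMap y k) x h }, fun s => ?_⟩
    refine (F s).dense_span_of_ip _ fun f hf => (hR s).eq_zero_of_ip_kernelMap fun x h => ?_
    exact hf _ (Set.mem_iUnion.2 ⟨x, h, rfl⟩)
  tfae_have 6 → 2 := by
    -- Any linearisation suffices here; minimality plays no role in domination.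
    rintro ⟨Λ, -⟩
    choose L hL hLK using fun s => (Λ.symmetry s).exists_dominating
      (K := restrictKernel (P s) K) (fun x y => hK s x x.2 y y.2) (Λ.V s) (Λ.V_bounded s)
      fun x y h k => Λ.factorisation s x y h k
    have hres := hP.restrictKernel_glueKernel L
    refine ⟨hP.glueKernel L, isPartiallyPosSemidef_iff.2 fun s => (hres s).symm ▸ hL s,
      isPartiallyPosSemidef_iff.2 fun s => ?_⟩
    change IsPosSemidefKernel (restrictKernel (P s) (hP.glueKernel L) - restrictKernel (P s) K)
    rw [hres]
    exact hLK s
  tfae_finish
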